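/- Let $\ell^2$ be the real Hilbert space of square-summable sequences. For a set-valued operator $A\colon H\rightrightarrows H$ on a real Hilbert space write $\operatorname{dom}A=\{x: Ax\neq\varnothing\}$, $\operatorname{zer}A=\{x: 0\in Ax\}$, $J_A=(\operatorname{Id}+A)^{-1}$; $A$ is monotone if $\langle x-y,v-w\rangle\ge 0$ whenever $v\in Ax$, $w\in Ay$, and maximally monotone if in addition no monotone operator has a strictly larger graph. There exist a maximally monotone operator $B$ on $\ell^2$ with bounded domain and with $J_B$ single-valued and everywhere defined, a starting point $s_0\in\ell^2$, and a point $\bar s\in\operatorname{zer}B$ such that $(J_B^k s_0)_{k\in\mathbb N}$ converges weakly to $\bar s$ but does not converge strongly. Moreover, the same $B$, $s_0$, $\bar s$ satisfy the following. (i) (Douglas–Rachford with $A_1=B$, $A_2=0$.) On $H=\ell^2\times\ell^2$ let $A(x,y)=(A_1x+y)\times(-x+A_2^{-1}y)$, let $C\colon\ell^2\to H$, $Cw=(w,-w)$, and $M=CC^*$. Then $T=(M+A)^{-1}M$ and $\widetilde T=C^*(M+A)^{-1}C$ are single-valued and everywhere defined, $(\bar s,0)\in\operatorname{zer}A$, and,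 with $u_0=(s_0,0)$ and $w_0=C^*u_0$, the sequences $(T^ku_0)_{k\in\mathbb N}$ and $(\widetilde T^kw_0)_{k\in\mathbb N}$ converge weakly to $(\bar s,0)$ and to $\bar s$, respectively, but neither converges strongly. (ii) (Chambolle–Pock with $A_1=\sigma^{-1}B$, $A_2=0$.) Let $Y$ be any real Hilbert space, $L\colon\ell^2\to Y$ any continuous linear operator, and $\sigma,\tau>0$ with $\sigma\tau\|L\|^2\le 1$. On $\ell^2\times Y$ let $A(x,y)=(A_1x+L^*y)\times(-Lx+A_2^{-1}y)$ and $M(x,y)=(\tfrac1\sigma x-L^*y,\,-Lx+\tfrac1\tau y)$. Then $T=(M+A)^{-1}M$ is single-valued and everywhere defined, $(\bar s,0)\in\operatorname{zer}A$, and $(T^k(s_0,0))_{k\in\mathbb N}$ converges weakly to $(\bar s,0)$ but does not converge strongly. -/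

import Mathlib

open Filter Topology

universe u

noncomputable section

namespace MonotoneOp

section General

variable {H : Type*} [NormedAddCommGroup H] [InnerProductSpace ℝ H]

/-- A set-valued operator `A : H ⇉ H` is a map `H → Set H`. It is monotone if
`⟪x - y, v - w⟫ ≥ 0` whenever `v ∈ A x` and `w ∈ A y`. -/
def IsMonotone (A : H → Set H) : Prop :=
  ∀ ⦃x y v w : H⦄, v ∈ A x → w ∈ A y → 0 ≤ inner ℝ (x - y) (v - w)

/-- `A` is maximally monotone: monotone, and no monotone operator has a strictly larger graph. -/
def IsMaximallyMonotone (A : H → Set H) : Prop :=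
  IsMonotone A ∧ ∀ A' : H → Set H, IsMonotone A' → (∀ x, A x ⊆ A' x) → A' = A

/-- The domain `{x | A x ≠ ∅}`. -/
def dom (A : H → Set H) : Set H := {x | (A x).Nonempty}

/-- The set of zeros `{x | 0 ∈ A x}`. -/
def zer (A : H → Set H) : Set H := {x | 0 ∈ A x}

/-- The set-valued inverse: `x ∈ A⁻¹ v` iff `v ∈ A x`. -/
def inv (A : H → Set H) : H → Set H := fun v => {x | v ∈ A x}

/-- The sum `M + A` of a single-valued map `M` and a set-valued operator `A`:
`v ∈ (M + A) x` iff `v - M x ∈ A x`. -/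
def addMap (M : H → H) (A : H → Set H) : H → Set H := fun x => {v | v - M x ∈ A x}

/-- The operator `c A : x ↦ {c v | v ∈ A x}`. -/
def scale (c : ℝ) (A : H → Set H) : H → Set H := fun x => (fun v => c • v) '' A x

/-- The operator `x ↦ {0}`. -/
def zeroOp (H : Type*) [Zero H] : H → Set H := fun _ => {0}

/-- The resolvent `J_A = (Id + A)⁻¹`, as a set-valued operator. -/
def resolventOp (A : H → Set H) : H → Set H := inv (addMap id A)

/-- Convergence in the weak topology of `H`. -/
def TendstoWeakly (s : ℕ → H) (x : H) : Prop :=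
  Tendsto (fun k => toWeakSpace ℝ H (s k)) atTop (𝓝 (toWeakSpace ℝ H x))

/-- `s` converges weakly to `x` and has no limit in norm. -/
def ConvergesOnlyWeakly (s : ℕ → H) (x : H) : Prop :=
  TendstoWeakly s x ∧ ¬ ∃ y : H, Tendsto s atTop (𝓝 y)

/-- The preconditioned proximal point operator `T = (M + A)⁻¹ M`. -/
def pppOp (M : H → H) (A : H → Set H) : H → Set H := fun z => inv (addMap M A) (M z)

/-- The reduced preconditioned proximal point operator `C* (M + A)⁻¹ C` on `D`,
where `C : D → H` and `M = C C*`. -/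
def reducedOp {D : Type*} [NormedAddCommGroup D] [InnerProductSpace ℝ D]
    [CompleteSpace D] [CompleteSpace H] (C : D →L[ℝ] H) (A : H → Set H) : D → Set D :=
  fun w => C.adjoint '' inv (addMap (C ∘L C.adjoint) A) (C w)

end General

section Splitting

variable {X : Type*} [NormedAddCommGroup X] [InnerProductSpace ℝ X] [CompleteSpace X]
variable {Y : Type*} [NormedAddCommGroup Y] [InnerProductSpace ℝ Y] [CompleteSpace Y]

/-- The block operator `(x, y) ↦ (A₁ x + L* y) × (- L x + A₂⁻¹ y)` on the Hilbert space `X × Y`,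
that is, `v` is in its value at `z` iff `v₁ - L* z₂ ∈ A₁ z₁` and `v₂ + L z₁ ∈ A₂⁻¹ z₂`. -/
def primalDualOp (L : X →L[ℝ] Y) (A₁ : X → Set X) (A₂ : Y → Set Y) :
    WithLp 2 (X × Y) → Set (WithLp 2 (X × Y)) :=
  fun z => {v | v.fst - L.adjoint z.snd ∈ A₁ z.fst ∧ v.snd + L z.fst ∈ inv A₂ z.snd}

/-- Douglas-Rachford: the operator `(x, y) ↦ (A₁ x + y) × (- x + A₂⁻¹ y)` on `X × X`. -/
def drA (A₁ A₂ : X → Set X) : WithLp 2 (X × X) → Set (WithLp 2 (X × X)) :=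
  primalDualOp (ContinuousLinearMap.id ℝ X) A₁ A₂

/-- Douglas-Rachford: the map `C : X → X × X`, `w ↦ (w, -w)`. -/
def drC (X : Type*) [NormedAddCommGroup X] [InnerProductSpace ℝ X] :
    X →L[ℝ] WithLp 2 (X × X) :=
  (WithLp.prodContinuousLinearEquiv 2 ℝ X X).symm.toContinuousLinearMap ∘L
    (ContinuousLinearMap.id ℝ X).prod (-ContinuousLinearMap.id ℝ X)

/-- Douglas-Rachford: the preconditioner `M = C C*`. -/
def drM (X : Type*) [NormedAddCommGroup X] [InnerProductSpace ℝ X] [CompleteSpace X] :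
    WithLp 2 (X × X) → WithLp 2 (X × X) :=
  drC X ∘L (drC X).adjoint

/-- Chambolle-Pock: the preconditioner `M (x, y) = (x / σ - L* y, - L x + y / τ)`. -/
def cpM (L : X →L[ℝ] Y) (σ τ : ℝ) : WithLp 2 (X × Y) → WithLp 2 (X × Y) :=
  fun z => WithLp.toLp 2
    (σ⁻¹ • z.fst - L.adjoint z.snd, - L z.fst + τ⁻¹ • z.snd)

end Splitting

/-- The real Hilbert space `ℓ²` of square-summable sequences. -/
abbrev Ell2 : Type := lp (fun _ : ℕ => ℝ) 2

end MonotoneOp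

end

noncomputable section

namespace MonotoneOp

/-! ### Scalar inequalities and the parameter sequence. -/

section Parameters

/-! Every firmly nonexpansive self-map `J` is the resolvent of a maximally monotone operator, so it
suffices to build such a `J` with bounded range, a fixed point, and an orbit that converges only
weakly. Take for `J y` the first component of the projection of `(y, 0)` onto a closed convex set in
`ℓ² × ℝ`; such a compression of a projection is firmly nonexpansive.

The set is the closed convex hull of `0` and suitable multiples of points `(Y a, exp (-a))`, where
the vectors `Y a` have Gram kernel `2 / (a + b)` (`exists_geomVec`). For fixed `b`, requiring the
projection of the ray through `(Y a, 0)` to be tangent to this curve at parameter `b` determines `a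
= prevParam b`, and `projection_ineq` turns tangency into a global inequality. Starting on the ray
of `a 0`, the orbit visits the rays of `a k`, with `prevParam (a (k + 1)) = a k` and `a k → ∞`, so
its coordinates tend to `0`. The relative loss of squared norm per step is at most `2 (1 / a k - 1 /
a (k + 1))` (`norm_ratio_bounds`); this telescopes, so the norms stay away from `0`.

In both splittings `A₂ = 0` forces the second component of the output to vanish, and on points `(x,
0)` the operator `T` acts as `J`. -/

theorem nonneg_of_tangency {b m d : ℝ} (hb : 10 ≤ b) (hm : 2 * b - 2 ≤ m) (hm' : m ≤ 2 * b - 1)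
    (hd : -b ≤ d) :
    0 ≤ (1 + m + d) * Real.exp (-d) - (1 + m) + 2 * b * m * d / (2 * b + d) := by
  have hpos : 0 < 2 * b + d := by linarith
  have key : (1 + m + d) * Real.exp (-d) - (1 + m) + 2 * b * m * d / (2 * b + d)
      = (1 + m + d) * Real.exp (-d) - (1 + m) + m * d - m * d ^ 2 / (2 * b + d) := by
    field_simp
    ring
  -- The expression vanishes to second order at `d = 0`. For `d ≤ 0` and `0 ≤ d ≤ 2` a quadratic
  -- lower bound for `exp (-d)` beats the term `m d² / (2b + d)`; for `d ≥ 2` the exponential can be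
  -- dropped.
  rcases le_total d 0 with h0 | h0
  · rw [key]
    have h1 := Real.quadratic_le_exp_of_nonneg (x := -d) (by linarith)
    have h2 : m * d ^ 2 / (2 * b + d) ≤ 2 * d ^ 2 := by
      rw [div_le_iff₀ hpos]
      nlinarith [mul_nonneg (sq_nonneg d) (by linarith : 0 ≤ 2 * (2 * b + d) - m)]
    nlinarith [mul_le_mul_of_nonneg_left h1 (by linarith : 0 ≤ 1 + m + d),
      mul_nonneg (sq_nonneg d) (by linarith : 0 ≤ 1 + m + d - 6)]
  rcases le_total d 2 with h2 | h2
  · rw [key]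
    have h3 : (1 - d / 2) ^ 2 ≤ Real.exp (-d) := by
      have h4 := Real.add_one_le_exp (-(d / 2))
      have h5 : Real.exp (-d) = Real.exp (-(d / 2)) ^ 2 := by
        rw [← Real.exp_nat_mul]
        congr 1
        push_cast
        ring
      rw [h5]
      exact pow_le_pow_left₀ (by linarith) (by linarith) 2
    have h6 : m * d ^ 2 / (2 * b + d) ≤ d ^ 2 := by
      rw [div_le_iff₀ hpos]
      nlinarith [mul_nonneg (sq_nonneg d) (by linarith : 0 ≤ (2 * b + d) - m)]
    nlinarith [mul_le_mul_of_nonneg_left h3 (by linarith : 0 ≤ 1 + m + d),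
      mul_nonneg (sq_nonneg d) (by linarith : 0 ≤ m - 11), mul_nonneg (sq_nonneg d) h0]
  · have h3 : 0 ≤ (1 + m + d) * Real.exp (-d) := by
      have := Real.exp_pos (-d)
      have : 0 ≤ 1 + m + d := by linarith
      positivity
    have h4 : 1 + m ≤ 2 * b * m * d / (2 * b + d) := by
      rw [le_div_iff₀ hpos]
      nlinarith [mul_nonneg (mul_nonneg (by linarith : 0 ≤ b) (by linarith : 0 ≤ m))
        (by linarith : 0 ≤ d - 2), mul_nonneg (by linarith : 0 ≤ b - 10) (by linarith : 0 ≤ m),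
        mul_nonneg (mul_nonneg (by linarith : 0 ≤ b - 10) (by linarith : 0 ≤ m))
        (by linarith : 0 ≤ d - 2), mul_nonneg (by linarith : 0 ≤ d - 2) (by linarith : 0 ≤ m)]
    linarith

/-- The slope at which the projection onto the cone over the curve
`a ↦ (geomVec a, exp (-a))` is tangent to it. -/
def slope (b : ℝ) : ℝ := (2 * b - 1) / (1 + 2 * b ^ 2 * Real.exp (-b) ^ 2)

/-- The parameter of the ray that is projected onto the ray with parameter `b`. -/
def prevParam (b : ℝ) : ℝ := slope b + 1 - b

theorem exp_neg_sq_bound {b : ℝ} (hb : 10 ≤ b) : 4 * b ^ 3 * Real.exp (-b) ^ 2 ≤ 1 := by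
  have h1 := Real.pow_div_factorial_le_exp (2 * b) (by linarith) 4
  have h2 : Real.exp (-b) ^ 2 = (Real.exp (2 * b))⁻¹ := by
    rw [← Real.exp_nat_mul, ← Real.exp_neg]
    congr 1
    push_cast
    ring
  have h3 := Real.exp_pos (2 * b)
  rw [h2, ← div_eq_mul_inv, div_le_one h3]
  refine le_trans ?_ h1
  norm_num [Nat.factorial]
  nlinarith [pow_pos (by linarith : 0 < b) 3]

theorem slope_mul (b : ℝ) : slope b * (1 + 2 * b ^ 2 * Real.exp (-b) ^ 2) = 2 * b - 1 := by
  have : 0 < 1 + 2 * b ^ 2 * Real.exp (-b) ^ 2 := by positivity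
  rw [slope, div_mul_cancel₀ _ this.ne']

theorem slope_lt {b : ℝ} (hb : 10 ≤ b) : slope b < 2 * b - 1 := by
  have : 0 < 2 * b ^ 2 * Real.exp (-b) ^ 2 := by positivity
  rw [slope, div_lt_iff₀ (by linarith)]
  nlinarith

theorem le_slope {b : ℝ} (hb : 10 ≤ b) : 2 * b - 2 ≤ slope b := by
  have h0 : 0 < 2 * b ^ 2 * Real.exp (-b) ^ 2 := by positivity
  rw [slope, le_div_iff₀ (by linarith)]
  nlinarith [exp_neg_sq_bound hb]

theorem prevParam_lt {b : ℝ} (hb : 10 ≤ b) : prevParam b < b := by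
  have := slope_lt hb
  rw [prevParam]
  linarith

theorem le_prevParam {b : ℝ} (hb : 10 ≤ b) : b - 1 ≤ prevParam b := by
  have := le_slope hb
  rw [prevParam]
  linarith

theorem continuous_prevParam : Continuous prevParam := by
  unfold prevParam slope
  have : ∀ b : ℝ, 1 + 2 * b ^ 2 * Real.exp (-b) ^ 2 ≠ 0 := fun b => by positivity
  fun_prop (disch := assumption)

theorem exists_prevParam_eq {a : ℝ} (ha : 10 ≤ a) : ∃ b, a ≤ b ∧ prevParam b = a := by
  have h := intermediate_value_Icc (by linarith : a ≤ a + 1) continuous_prevParam.continuousOn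
  obtain ⟨b, hb, hab⟩ := h ⟨(prevParam_lt ha).le, by
    linarith [le_prevParam (b := a + 1) (by linarith)]⟩
  exact ⟨b, hb.1, hab⟩

theorem exists_param_seq : ∃ a : ℕ → ℝ, (∀ k, 10 ≤ a k) ∧ Monotone a ∧
    (∀ k, prevParam (a (k + 1)) = a k) ∧ Tendsto a atTop atTop := by
  choose! f hf using fun (a : ℝ) (ha : 10 ≤ a) => exists_prevParam_eq ha
  let a : ℕ → ℝ := fun k => f^[k] 10
  have hs : ∀ k, a (k + 1) = f (a k) := fun k => Function.iterate_succ_apply' f k 10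
  have h10 : ∀ k, 10 ≤ a k := by
    intro k
    induction k with
    | zero => exact le_rfl
    | succ k ih => rw [hs]; exact ih.trans (hf _ ih).1
  have hp : ∀ k, prevParam (a (k + 1)) = a k := fun k => by rw [hs]; exact (hf _ (h10 k)).2
  have hmono : Monotone a := monotone_nat_of_le_succ fun k => by
    rw [hs]; exact (hf _ (h10 k)).1
  refine ⟨a, h10, hmono, hp, ?_⟩
  -- A finite limit would be a fixed point of `prevParam`, which lies strictly below the identity.
  rcases tendsto_atTop_of_monotone hmono with h | ⟨l, hl⟩
  · exact h
  · have h1 : Tendsto (fun k => prevParam (a (k + 1))) atTop (𝓝 (prevParam l)) :=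
      (continuous_prevParam.tendsto l).comp ((tendsto_add_atTop_iff_nat 1).2 hl)
    simp only [hp] at h1
    have h2 := tendsto_nhds_unique h1 hl
    have h3 : 10 ≤ l := ge_of_tendsto' hl h10
    exact absurd h2 (prevParam_lt h3).ne

/-- Equality holds at `c = b`, and `prevParam b` is the value for which the derivatives in `c` also
agree there. The difference of the two sides is a positive multiple of the function in
`nonneg_of_tangency` at `d = c - b`. -/
theorem projection_ineq {b c : ℝ} (hb : 10 ≤ b) (hc : 10 ≤ c) :
    2 / (prevParam b + c) * (1 / b + Real.exp (-b) ^ 2) ≤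
      2 / (prevParam b + b) * (2 / (b + c) + Real.exp (-b) * Real.exp (-c)) := by
  have hG := nonneg_of_tangency hb (le_slope hb) (slope_lt hb).le (d := c - b) (by linarith)
  have hs := slope_mul b
  have hs1 := le_slope hb
  have hexp : Real.exp (-c) = Real.exp (-b) * Real.exp (-(c - b)) := by
    rw [← Real.exp_add]
    congr 1
    ring
  rw [hexp, ← mul_assoc, ← sq, prevParam]
  set m := slope b
  set D := Real.exp (-(c - b))
  have hu0 : 0 < Real.exp (-b) ^ 2 := by positivity
  set u := Real.exp (-b) ^ 2
  have hm : 0 < m := by linarith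
  have hb0 : 0 < b := by linarith
  have hc0 : 0 < b + c := by linarith
  have hmc : 0 < m + 1 - b + c := by linarith
  -- The formula defining the slope, solved for `exp (-b) ^ 2`; this makes the identity below
  -- rational apart from `D`.
  have hu : u = (2 * b - 1 - m) / (2 * b ^ 2 * m) := by
    rw [eq_div_iff (by positivity)]
    linarith
  have hid : 2 / (m + 1 - b + b) * (2 / (b + c) + u * D) - 2 / (m + 1 - b + c) * (1 / b + u)
      = 2 * u / ((m + 1) * (m + 1 - b + c)) *
        ((1 + m + (c - b)) * D - (1 + m) + 2 * b * m * (c - b) / (2 * b + (c - b))) := by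
    have e1 : 2 * b + (c - b) = b + c := by ring
    have e2 : m + 1 - b + b = m + 1 := by ring
    rw [e1, e2, hu]
    field_simp
    ring
  have : 0 ≤ 2 * u / ((m + 1) * (m + 1 - b + c)) *
        ((1 + m + (c - b)) * D - (1 + m) + 2 * b * m * (c - b) / (2 * b + (c - b))) := by
    positivity
  linarith

/-- The factor by which the squared norm shrinks in one step. -/
theorem norm_ratio_bounds {b : ℝ} (hb : 10 ≤ b) (ha : 10 ≤ prevParam b) :
    1 - 2 * (1 / prevParam b - 1 / b) ≤
        4 * prevParam b * b / ((prevParam b + b) * (1 + b * Real.exp (-b) ^ 2)) ^ 2 ∧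
      4 * prevParam b * b / ((prevParam b + b) * (1 + b * Real.exp (-b) ^ 2)) ^ 2 ≤ 1 := by
  have hm1 := le_slope hb
  have hs := slope_mul b
  have hlt := prevParam_lt hb
  have hge := le_prevParam hb
  -- The parameter increment is itself of order `b ^ 3 * u`, so both sources of norm loss, the term
  -- `b * u` and the square of `(b - a) / (a + b)`, are `O((b - a) / b ^ 2)`.
  have hσ : b - prevParam b = slope b * (2 * b ^ 2 * Real.exp (-b) ^ 2) := by
    rw [prevParam]
    linarith
  have hu0 : 0 < Real.exp (-b) ^ 2 := by positivity
  set u := Real.exp (-b) ^ 2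
  set a := prevParam b
  have hE : 0 ≤ b * u := by positivity
  have hE1 : b * u ≤ (b - a) / (2 * b ^ 2) := by
    rw [hσ, le_div_iff₀ (by positivity)]
    have : 0 ≤ b ^ 2 * u := by positivity
    nlinarith [mul_nonneg this (by linarith : 0 ≤ slope b - b)]
  have hab : 4 * a * b / ((a + b) * (1 + b * u)) ^ 2
      = (1 - ((b - a) / (a + b)) ^ 2) * (1 / (1 + b * u) ^ 2) := by
    have : a + b ≠ 0 := by linarith
    field_simp
    ring
  have h1 : ((b - a) / (a + b)) ^ 2 ≤ (b - a) / b ^ 2 := by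
    rw [div_pow]
    apply div_le_div₀ (by linarith) (by nlinarith) (by positivity)
    apply pow_le_pow_left₀ <;> linarith
  have h2 : 1 - 2 * (b * u) ≤ 1 / (1 + b * u) ^ 2 := by
    rw [le_div_iff₀ (by positivity)]
    nlinarith [pow_nonneg hE 3, pow_nonneg hE 2]
  have h2' : 1 / (1 + b * u) ^ 2 ≤ 1 := by
    rw [div_le_one (by positivity)]
    nlinarith
  have h3 : 0 ≤ ((b - a) / (a + b)) ^ 2 := sq_nonneg _
  have h4 : (b - a) / b ^ 2 ≤ 1 / a - 1 / b := by
    have : 1 / a - 1 / b = (b - a) / (a * b) := by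
      have : a ≠ 0 := by linarith
      field_simp
    rw [this]
    apply div_le_div_of_nonneg_left (by linarith) (by nlinarith) (by nlinarith)
  have h5 : (b - a) / b ^ 2 ≤ 1 := by
    rw [div_le_one (by positivity)]
    nlinarith
  have h6 : (b - a) / (2 * b ^ 2) = (b - a) / b ^ 2 / 2 := by
    field_simp
  rw [h6] at hE1
  have h7 : 0 ≤ 1 / (1 + b * u) ^ 2 := by positivity
  rw [hab]
  constructor
  · nlinarith [mul_nonneg (by linarith : 0 ≤ 1 - ((b - a) / (a + b)) ^ 2) (sub_nonneg.2 h2)]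
  · nlinarith

end Parameters

/-! ### The curve in `ℓ²` and the orbit on it. -/

section Curve

/-- The inner products are geometric series. The vectors are the functions `√2 exp (-a t)` of `L²(0,
∞)`, expanded in the Laguerre basis. -/
theorem exists_geomVec : ∃ Y : ℝ → Ell2,
    (∀ a, 0 < a → ∀ n, (Y a : ℕ → ℝ) n = 2 / (a + 1) * ((a - 1) / (a + 1)) ^ n) ∧
    ∀ a b, 0 < a → 0 < b → inner ℝ (Y a) (Y b) = 2 / (a + b) := by
  have habs : ∀ a : ℝ, 0 < a → |(a - 1) / (a + 1)| < 1 := fun a ha => by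
    rw [abs_div, abs_of_pos (by linarith : 0 < a + 1), div_lt_one (by linarith), abs_lt]
    constructor <;> linarith
  have hY : ∀ a : ℝ, 0 < a → ∃ y : Ell2,
      ∀ n, (y : ℕ → ℝ) n = 2 / (a + 1) * ((a - 1) / (a + 1)) ^ n := by
    intro a ha
    have hmem : Memℓp (fun n : ℕ => 2 / (a + 1) * ((a - 1) / (a + 1)) ^ n) 2 := by
      apply memℓp_gen
      have h1 : |((a - 1) / (a + 1)) ^ 2| < 1 := by
        rw [abs_pow]
        exact pow_lt_one₀ (abs_nonneg _) (habs a ha) two_ne_zero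
      refine ((summable_geometric_of_abs_lt_one h1).mul_left ((2 / (a + 1)) ^ 2)).congr ?_
      intro n
      simp only [ENNReal.toReal_ofNat, Real.rpow_ofNat, Real.norm_eq_abs, sq_abs]
      rw [mul_pow, ← pow_mul, ← pow_mul, mul_comm 2 n]
    exact ⟨⟨_, hmem⟩, fun n => rfl⟩
  choose! Y hY using hY
  refine ⟨Y, hY, fun a b ha hb => ?_⟩
  have h1 : |(a - 1) / (a + 1) * ((b - 1) / (b + 1))| < 1 := by
    rw [abs_mul]
    exact mul_lt_one_of_nonneg_of_lt_one_left (abs_nonneg _) (habs a ha) (habs b hb).le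
  have h2 := (hasSum_geometric_of_abs_lt_one h1).mul_left (2 / (a + 1) * (2 / (b + 1)))
  have h3 : 2 / (a + 1) * (2 / (b + 1)) * (1 - (a - 1) / (a + 1) * ((b - 1) / (b + 1)))⁻¹
      = 2 / (a + b) := by
    have h4 : 1 - (a - 1) / (a + 1) * ((b - 1) / (b + 1))
        = 2 * (a + b) / ((a + 1) * (b + 1)) := by
      field_simp
      ring
    rw [h4, inv_div]
    field_simp
  have h5 : ∀ n, 2 / (a + 1) * (2 / (b + 1)) * ((a - 1) / (a + 1) * ((b - 1) / (b + 1))) ^ n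
      = inner ℝ ((Y a : ℕ → ℝ) n) ((Y b : ℕ → ℝ) n) := fun n => by
    rw [hY a ha, hY b hb, mul_pow]
    simp only [RCLike.inner_apply, conj_trivial]
    ring
  simp only [h5, h3] at h2
  exact (lp.hasSum_inner (𝕜 := ℝ) (Y a) (Y b)).unique h2

theorem tendstoWeakly_of_forall_inner {H : Type*} [NormedAddCommGroup H] [InnerProductSpace ℝ H]
    [CompleteSpace H] {s : ℕ → H} {x : H}
    (h : ∀ y, Tendsto (fun k => inner ℝ (s k) y) atTop (𝓝 (inner ℝ x y))) :
    TendstoWeakly s x := by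
  refine (WeakBilin.tendsto_iff_forall_eval_tendsto (topDualPairing ℝ H).flip ?_).2 ?_
  · intro u v huv
    refine ext_inner_left ℝ fun y => ?_
    exact DFunLike.congr_fun huv (InnerProductSpace.toDual ℝ H y)
  · intro f
    have h1 : ∀ u : H, f u = inner ℝ u ((InnerProductSpace.toDual ℝ H).symm f) := fun u => by
      rw [real_inner_comm, InnerProductSpace.toDual_symm_apply]
    change Tendsto (fun k => f (s k)) atTop (𝓝 (f x))
    simp only [h1]
    exact h _

theorem tendsto_inner_of_tendstoWeakly {H : Type*} [NormedAddCommGroup H] [InnerProductSpace ℝ H]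
    {s : ℕ → H} {x : H} (h : TendstoWeakly s x) (y : H) :
    Tendsto (fun k => inner ℝ (s k) y) atTop (𝓝 (inner ℝ x y)) := by
  have h1 := (WeakBilin.eval_continuous (topDualPairing ℝ H).flip (innerSL ℝ y)).tendsto
    (toWeakSpace ℝ H x)
  have h2 : Tendsto (fun k => inner ℝ y (s k)) atTop (𝓝 (inner ℝ y x)) := h1.comp h
  simpa only [real_inner_comm] using h2

/-- Finitely supported vectors are dense, and the uniform norm bound controls the error of
truncating the test vector. -/
theorem tendstoWeakly_zero_of_coord {s : ℕ → Ell2} (hs : ∀ k, ‖s k‖ ≤ 1)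
    (h : ∀ n, Tendsto (fun k => (s k : ℕ → ℝ) n) atTop (𝓝 0)) : TendstoWeakly s 0 := by
  refine tendstoWeakly_of_forall_inner fun y => ?_
  rw [inner_zero_left, Metric.tendsto_atTop]
  intro ε hε
  have hy := lp.hasSum_single (p := 2) (by simp) y
  obtain ⟨F, hF⟩ := (Metric.tendsto_atTop.1 hy) (ε / 2) (half_pos hε)
  set z : Ell2 := ∑ i ∈ F, lp.single 2 i ((y : ℕ → ℝ) i) with hz
  have h1 : Tendsto (fun k => inner ℝ (s k) z) atTop (𝓝 0) := by
    simp only [hz, inner_sum, lp.inner_single_right]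
    have h2 := tendsto_finsetSum F fun i _ => (h i).const_mul ((y : ℕ → ℝ) i)
    simp only [mul_zero, Finset.sum_const_zero] at h2
    exact h2
  obtain ⟨N, hN⟩ := (Metric.tendsto_atTop.1 h1) (ε / 2) (half_pos hε)
  refine ⟨N, fun k hk => ?_⟩
  have h2 := hN k hk
  have h3 := hF F le_rfl
  rw [dist_eq_norm] at h3
  rw [Real.dist_eq, sub_zero] at h2 ⊢
  have h4 : inner ℝ (s k) y = inner ℝ (s k) z - inner ℝ (s k) (z - y) := by
    rw [inner_sub_right]
    ring
  have h5 : |inner ℝ (s k) (z - y)| ≤ ‖z - y‖ := by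
    refine (abs_real_inner_le_norm _ _).trans ?_
    exact mul_le_of_le_one_left (norm_nonneg _) (hs k)
  rw [h4]
  refine (abs_sub _ _).trans_lt ?_
  linarith

/-- A sequence whose steps `x k - x (k + 1)`, paired with the heights `-h k`, are normal to the
cone spanned by the points `(x (k + 1), h k)`. -/
theorem exists_seq_with_normal_steps : ∃ (x : ℕ → Ell2) (h : ℕ → ℝ),
    (∀ k j, inner ℝ (x k - x (k + 1)) (x (j + 1)) ≤ h k * h j) ∧
    (∀ k, inner ℝ (x k - x (k + 1)) (x (k + 1)) = h k * h k) ∧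
    (∀ k, ‖x k‖ ≤ 1) ∧ (∀ k, 4 / 5 ≤ ‖x k‖ ^ 2) ∧ TendstoWeakly x 0 := by
  obtain ⟨Y, hYn, hY⟩ := exists_geomVec
  obtain ⟨a, h10, hmono, hp, hinf⟩ := exists_param_seq
  -- The multiplier for which equality holds at `c = b` in the projection inequality, with `b = a (k
  -- + 1)`; see `hgk`.
  let g : ℕ → ℝ := fun k => 2 * a (k + 1) /
    ((a k + a (k + 1)) * (1 + a (k + 1) * Real.exp (-a (k + 1)) ^ 2))
  have ha0 : ∀ k, 0 < a k := fun k => by linarith [h10 k]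
  have hg : ∀ k, 0 < g k := fun k => by
    have := ha0 k
    have := ha0 (k + 1)
    positivity
  -- Since `‖Y a‖ ^ 2 = 1 / a`, the choice `r 0 = √(a 0)` makes the starting point a unit vector.
  obtain ⟨r, hr, hrs, hr0⟩ : ∃ r : ℕ → ℝ, (∀ k, 0 < r k) ∧ (∀ k, r (k + 1) = r k * g k) ∧
      r 0 = √(a 0) :=
    ⟨fun k => √(a 0) * ∏ i ∈ Finset.range k, g i,
      fun k => mul_pos (Real.sqrt_pos.2 (ha0 0)) (Finset.prod_pos fun i _ => hg i),
      fun k => by simp only [Finset.prod_range_succ, mul_assoc], by simp⟩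
  have hx : ∀ k j, inner ℝ (r k • Y (a k)) (r j • Y (a j)) = r k * r j * (2 / (a k + a j)) :=
    fun k j => by
      rw [real_inner_smul_left, real_inner_smul_right, hY _ _ (ha0 k) (ha0 j)]
      ring
  have hgk : ∀ k, g k * (1 / a (k + 1) + Real.exp (-a (k + 1)) ^ 2)
      = 2 / (a k + a (k + 1)) := fun k => by
    have := ha0 k
    have := ha0 (k + 1)
    simp only [g]
    field_simp
  have hnorm : ∀ k, ‖r k • Y (a k)‖ ^ 2 = r k ^ 2 / a k := fun k => by
    have := ha0 k
    rw [← real_inner_self_eq_norm_sq, hx]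
    field_simp
    ring
  have hR0 : r 0 ^ 2 / a 0 = 1 := by
    rw [hr0, Real.sq_sqrt (ha0 0).le, div_self (ha0 0).ne']
  have hstep : ∀ k, r (k + 1) ^ 2 / a (k + 1) = r k ^ 2 / a k *
      (4 * a k * a (k + 1) / ((a k + a (k + 1)) *
        (1 + a (k + 1) * Real.exp (-a (k + 1)) ^ 2)) ^ 2) := fun k => by
    have := ha0 k
    have := ha0 (k + 1)
    rw [hrs]
    simp only [g]
    field_simp
    ring
  have hratio := fun k => norm_ratio_bounds (h10 (k + 1)) ((hp k).symm ▸ h10 k)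
  simp only [hp] at hratio
  have hRnn : ∀ k, 0 ≤ r k ^ 2 / a k := fun k => div_nonneg (sq_nonneg _) (ha0 k).le
  have hR1 : ∀ k, r k ^ 2 / a k ≤ 1 := by
    intro k
    induction k with
    | zero => exact hR0.le
    | succ k ih =>
      rw [hstep]
      exact (mul_le_of_le_one_right (hRnn k) (hratio k).2).trans ih
  have hx1 : ∀ k, ‖r k • Y (a k)‖ ≤ 1 := fun k => by
    have := hR1 k
    rw [← hnorm] at this
    nlinarith [norm_nonneg (r k • Y (a k))]
  refine ⟨fun k => r k • Y (a k), fun k => r (k + 1) * Real.exp (-a (k + 1)), ?_, ?_, hx1, ?_, ?_⟩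
  · intro k j
    rw [inner_sub_left, hx, hx, hrs k]
    have h1 := projection_ineq (h10 (k + 1)) (h10 (j + 1))
    rw [hp, ← hgk k] at h1
    have hpos : 0 < 1 / a (k + 1) + Real.exp (-a (k + 1)) ^ 2 := by
      have := ha0 (k + 1)
      positivity
    have h2 : 2 / (a k + a (j + 1)) ≤ g k *
        (2 / (a (k + 1) + a (j + 1)) + Real.exp (-a (k + 1)) * Real.exp (-a (j + 1))) := by
      refine le_of_mul_le_mul_right ?_ hpos
      linarith
    have h3 := mul_le_mul_of_nonneg_left h2 (mul_pos (hr k) (hr (j + 1))).le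
    simp only [hrs]
    simp only [hrs] at h3
    linarith
  · intro k
    rw [inner_sub_left, hx, hx, ← hgk k]
    simp only [hrs]
    have := ha0 (k + 1)
    field_simp
    ring
  · intro k
    rw [hnorm]
    -- The losses telescope; with `a 0 ≥ 10` they total at most `2 / 10`, whence `4 / 5`.
    have hlow : ∀ k, r 0 ^ 2 / a 0 - 2 * (1 / a 0 - 1 / a k) ≤ r k ^ 2 / a k := by
      intro k
      induction k with
      | zero => simp
      | succ k ih =>
        have h1 : 1 / a (k + 1) ≤ 1 / a k := one_div_le_one_div_of_le (ha0 k) (hmono k.le_succ)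
        have h2 := mul_le_mul_of_nonneg_left (hratio k).1 (hRnn k)
        rw [← hstep] at h2
        nlinarith [mul_nonneg (sub_nonneg.2 (hR1 k)) (sub_nonneg.2 h1)]
    have h1 := hlow k
    have h2 : 1 / a 0 ≤ 1 / 10 := one_div_le_one_div_of_le (by norm_num) (h10 0)
    have h3 : 0 < 1 / a k := one_div_pos.2 (ha0 k)
    linarith
  · refine tendstoWeakly_zero_of_coord hx1 fun n => ?_
    have h1 : Tendsto (fun k => 2 / √(a k)) atTop (𝓝 0) :=
      tendsto_const_nhds.div_atTop (Real.tendsto_sqrt_atTop.comp hinf)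
    refine squeeze_zero_norm (fun k => ?_) h1
    have hk := ha0 k
    have h2 : r k ≤ √(a k) := by
      refine Real.le_sqrt_of_sq_le ?_
      have := hR1 k
      rwa [div_le_one hk] at this
    have h3 : |((a k - 1) / (a k + 1)) ^ n| ≤ 1 := by
      rw [abs_pow]
      refine pow_le_one₀ (abs_nonneg _) ?_
      rw [abs_div, abs_of_pos (by linarith : 0 < a k + 1), div_le_one (by linarith), abs_le]
      constructor <;> linarith
    rw [lp.coeFn_smul, Pi.smul_apply, hYn _ hk, smul_eq_mul, Real.norm_eq_abs, abs_mul, abs_mul,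
      abs_of_pos (hr k), abs_of_pos (by positivity : 0 < 2 / (a k + 1))]
    calc r k * (2 / (a k + 1) * |((a k - 1) / (a k + 1)) ^ n|)
        ≤ √(a k) * (2 / (a k) * 1) := by
          gcongr
          linarith
      _ = 2 / √(a k) := by
          have h4 : √(a k) * √(a k) = a k := Real.mul_self_sqrt hk.le
          have h5 : 0 < √(a k) := Real.sqrt_pos.2 hk
          rw [mul_one, eq_div_iff h5.ne']
          rw [mul_right_comm, h4]
          field_simp

end Curve

/-! ### Projections, firmly nonexpansive maps and resolvents. -/

section FirmlyNonexpansive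

variable {H : Type*} [NormedAddCommGroup H] [InnerProductSpace ℝ H]

/-- A map `J` is firmly nonexpansive if `‖J p - J q‖² ≤ ⟪J p - J q, p - q⟫`. -/
def IsFirmlyNonexpansive (J : H → H) : Prop :=
  ∀ p q, inner ℝ (J p - J q) (J p - J q) ≤ inner ℝ (J p - J q) (p - q)

/-- `P` is the metric projection onto `K`. -/
def IsProjection (K : Set H) (P : H → H) : Prop :=
  ∀ u, P u ∈ K ∧ ∀ w ∈ K, inner ℝ (u - P u) (w - P u) ≤ 0

theorem exists_isProjection [CompleteSpace H] {K : Set H} (hne : K.Nonempty) (hcl : IsClosed K)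
    (hconv : Convex ℝ K) : ∃ P : H → H, IsProjection K P := by
  have h : ∀ u, ∃ v ∈ K, ∀ w ∈ K, inner ℝ (u - v) (w - v) ≤ 0 := fun u => by
    obtain ⟨v, hv, huv⟩ := exists_norm_eq_iInf_of_complete_convex hne hcl.isComplete hconv u
    exact ⟨v, hv, (norm_eq_iInf_iff_real_inner_le_zero hconv hv).1 huv⟩
  choose P hP using h
  exact ⟨P, hP⟩

theorem IsProjection.isFirmlyNonexpansive {K : Set H} {P : H → H} (hP : IsProjection K P) :
    IsFirmlyNonexpansive P := by
  intro p q
  have h1 := (hP p).2 _ (hP q).1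
  have h2 := (hP q).2 _ (hP p).1
  simp only [inner_sub_left, inner_sub_right] at h1 h2 ⊢
  simp only [real_inner_comm p, real_inner_comm q, real_inner_comm (P p) (P q)] at h1 h2 ⊢
  linarith

theorem IsProjection.eq_of_forall_inner_le {K : Set H} {P : H → H} (hP : IsProjection K P)
    {u v : H} (hv : v ∈ K) (h : ∀ w ∈ K, inner ℝ (u - v) (w - v) ≤ 0) : P u = v := by
  have h1 := (hP u).2 _ hv
  have h2 := h _ (hP u).1
  have h3 : inner ℝ (P u - v) (P u - v) ≤ 0 := by
    have e : P u - v = (u - v) - (u - P u) := by abel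
    have e' : inner ℝ (u - P u) (P u - v) = - inner ℝ (u - P u) (v - P u) := by
      rw [← inner_neg_right, neg_sub]
    nth_rewrite 1 [e]
    rw [inner_sub_left, e']
    linarith
  exact sub_eq_zero.1 (inner_self_eq_zero.1 (le_antisymm h3 real_inner_self_nonneg))

theorem forall_mem_closedConvexHull_inner_le {S : Set H} {u v : H}
    (h : ∀ w ∈ S, inner ℝ (u - v) (w - v) ≤ 0) :
    ∀ w ∈ closedConvexHull ℝ S, inner ℝ (u - v) (w - v) ≤ 0 := by
  have hset : {w | inner ℝ (u - v) (w - v) ≤ 0} =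
      {w | (innerSL ℝ (u - v)) w ≤ inner ℝ (u - v) v} := by
    ext w
    rw [Set.mem_ofPred_eq, Set.mem_ofPred_eq, inner_sub_right, innerSL_apply_apply, sub_nonpos]
  have hsub : closedConvexHull ℝ S ⊆ {w | inner ℝ (u - v) (w - v) ≤ 0} := by
    refine closedConvexHull_min h ?_ ?_ <;> rw [hset]
    · exact convex_halfSpace_le (innerSL ℝ (u - v)).toLinearMap.isLinear _
    · exact isClosed_le (innerSL ℝ (u - v)).continuous continuous_const
  exact hsub

/-- The normality relations say that `(x k, 0)` projects onto `(x (k + 1), h k)`. Forgetting the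
height keeps firm nonexpansiveness, because the inputs all have height `0`. -/
theorem exists_isFirmlyNonexpansive_orbit : ∃ (J : Ell2 → Ell2) (x : ℕ → Ell2),
    IsFirmlyNonexpansive J ∧ Bornology.IsBounded (Set.range J) ∧ J 0 = 0 ∧
    (∀ k, J (x k) = x (k + 1)) ∧ ConvergesOnlyWeakly x 0 := by
  obtain ⟨x, h, hle, heq, hx1, hx2, hweak⟩ := exists_seq_with_normal_steps
  let v : ℕ → WithLp 2 (Ell2 × ℝ) := fun k => WithLp.toLp 2 (x (k + 1), h k)
  -- Including `0` makes it a fixed point of the projection, which gives the zero of the operator.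
  let S : Set (WithLp 2 (Ell2 × ℝ)) := insert 0 (Set.range v)
  have h0S : (0 : WithLp 2 (Ell2 × ℝ)) ∈ S := Set.mem_insert _ _
  have hvS : ∀ k, v k ∈ S := fun k => Set.mem_insert_of_mem _ ⟨k, rfl⟩
  obtain ⟨P, hP⟩ := exists_isProjection (K := closedConvexHull ℝ S)
    ⟨0, subset_closedConvexHull h0S⟩ isClosed_closedConvexHull convex_closedConvexHull
  let Q : Ell2 → WithLp 2 (Ell2 × ℝ) := fun y => WithLp.toLp 2 (y, 0)
  have hinner : ∀ k j, inner ℝ (Q (x k) - v k) (v j)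
      = inner ℝ (x k - x (k + 1)) (x (j + 1)) - h k * h j := fun k j => by
    simp [Q, v, WithLp.prod_inner_apply, mul_comm]
    ring
  have hself : ∀ k, inner ℝ (Q (x k) - v k) (v k) = 0 := fun k => by
    rw [hinner, heq, sub_self]
  have hPv : ∀ k, P (Q (x k)) = v k := fun k => by
    refine hP.eq_of_forall_inner_le (subset_closedConvexHull (hvS k))
      (forall_mem_closedConvexHull_inner_le ?_)
    rintro w (rfl | ⟨j, rfl⟩) <;> rw [inner_sub_right, hself]
    · simp
    · rw [hinner]
      linarith [hle k j]
  have hP0 : P (Q 0) = 0 := by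
    have hQ0 : Q 0 = 0 := rfl
    refine hP.eq_of_forall_inner_le (subset_closedConvexHull h0S) fun w _ => ?_
    simp [hQ0]
  -- Orthogonality of `Q (x k) - v k` to `v k` gives `‖v k‖ ^ 2 = ⟪x k, x (k + 1)⟫ ≤ 1`; this bounds
  -- the hull and so the range of `J`.
  have hv1 : ∀ k, ‖v k‖ ≤ 1 := fun k => by
    have h1 := hself k
    rw [inner_sub_left, sub_eq_zero, real_inner_self_eq_norm_sq] at h1
    have h2 : inner ℝ (Q (x k)) (v k) ≤ 1 := by
      have h3 : inner ℝ (Q (x k)) (v k) = inner ℝ (x k) (x (k + 1)) := by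
        simp [Q, v, WithLp.prod_inner_apply]
      rw [h3]
      refine (real_inner_le_norm _ _).trans ?_
      nlinarith [hx1 k, hx1 (k + 1), norm_nonneg (x k), norm_nonneg (x (k + 1))]
    nlinarith [norm_nonneg (v k)]
  have hK : closedConvexHull ℝ S ⊆ Metric.closedBall 0 1 := by
    refine closedConvexHull_min ?_ (convex_closedBall _ _) Metric.isClosed_closedBall
    rintro w (rfl | ⟨j, rfl⟩)
    · simp
    · simpa using hv1 j
  refine ⟨fun y => (P (Q y)).fst, x, fun p q => ?_, ?_, ?_, fun k => ?_, hweak, ?_⟩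
  · have h1 := hP.isFirmlyNonexpansive (Q p) (Q q)
    rw [WithLp.prod_inner_apply, WithLp.prod_inner_apply] at h1
    have h2 : inner ℝ (P (Q p) - P (Q q)).ofLp.2 (Q p - Q q).ofLp.2 = 0 := by
      simp [Q]
    have h3 := real_inner_self_nonneg (x := (P (Q p) - P (Q q)).ofLp.2)
    rw [h2, add_zero] at h1
    exact (le_add_of_nonneg_right h3).trans h1
  · refine (Metric.isBounded_closedBall (x := (0 : Ell2)) (r := 1)).subset ?_
    rintro _ ⟨y, rfl⟩
    have h1 := hK (hP (Q y)).1
    rw [mem_closedBall_zero_iff] at h1 ⊢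
    exact (WithLp.norm_fst_le Ell2 (P (Q y))).trans h1
  · simp only [hP0]
    rfl
  · simp only [hPv]
    rfl
  · rintro ⟨y, hy⟩
    have h1 : y = 0 := by
      refine ext_inner_right ℝ fun z => ?_
      exact tendsto_nhds_unique (hy.inner tendsto_const_nhds)
        (tendsto_inner_of_tendstoWeakly hweak z)
    have h2 := ge_of_tendsto' (hy.norm.pow 2) hx2
    rw [h1] at h2
    norm_num at h2

/-- The operator whose resolvent is `J`. -/
def ofResolvent (J : H → H) : H → Set H := fun x => {v | J (x + v) = x}

omit [InnerProductSpace ℝ H] in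
theorem resolventOp_ofResolvent (J : H → H) (x : H) : resolventOp (ofResolvent J) x = {J x} := by
  ext y
  simp [resolventOp, inv, addMap, ofResolvent, eq_comm]

omit [InnerProductSpace ℝ H] in
theorem dom_ofResolvent_subset (J : H → H) : dom (ofResolvent J) ⊆ Set.range J :=
  fun x ⟨v, hv⟩ => ⟨x + v, hv⟩

/-- Minty's argument: because `J` is defined everywhere, a pair `(x, v)` of a monotone extension can
be compared with the graph point over `J (x + v)` having the same sum, and monotonicity gives `-‖x -
J (x + v)‖ ^ 2 ≥ 0`. -/
theorem IsFirmlyNonexpansive.isMaximallyMonotone {J : H → H} (hJ : IsFirmlyNonexpansive J) :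
    IsMaximallyMonotone (ofResolvent J) := by
  refine ⟨fun x y v w hv hw => ?_, fun A' hA' hsub => ?_⟩
  · have h := hJ (x + v) (y + w)
    rw [show J (x + v) = x from hv, show J (y + w) = y from hw] at h
    have e : x + v - (y + w) = (x - y) + (v - w) := by abel
    rw [e, inner_add_right] at h
    linarith
  · funext x
    refine Set.Subset.antisymm (fun v hv => ?_) (hsub x)
    have hw : x + v - J (x + v) ∈ ofResolvent J (J (x + v)) := by simp [ofResolvent]
    have h := hA' hv (hsub _ hw)
    have e : v - (x + v - J (x + v)) = -(x - J (x + v)) := by abel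
    rw [e, inner_neg_right] at h
    have h0 := inner_self_eq_zero.1 (le_antisymm (neg_nonneg.1 h) real_inner_self_nonneg)
    exact (sub_eq_zero.1 h0).symm

end FirmlyNonexpansive

/-! ### Reduction of both splitting methods to the resolvent. -/

section Splitting

variable {X : Type*} [NormedAddCommGroup X] [InnerProductSpace ℝ X]
variable {Y : Type*} [NormedAddCommGroup Y] [InnerProductSpace ℝ Y]

theorem ConvergesOnlyWeakly.prod_zero {s : ℕ → X} {x : X} [CompleteSpace X] [CompleteSpace Y]
    (h : ConvergesOnlyWeakly s x) :
    ConvergesOnlyWeakly (fun k => WithLp.toLp 2 (s k, (0 : Y))) (WithLp.toLp 2 (x, 0)) := by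
  refine ⟨tendstoWeakly_of_forall_inner fun y => ?_, fun ⟨y, hy⟩ => h.2 ⟨y.fst, ?_⟩⟩
  · simpa [WithLp.prod_inner_apply] using tendsto_inner_of_tendstoWeakly h.1 y.fst
  · exact ((WithLp.continuous_fst 2 X Y).tendsto y).comp hy

omit [NormedAddCommGroup X] [InnerProductSpace ℝ X] [InnerProductSpace ℝ Y] in
theorem iterate_toLp_zero {J : X → X} {T : WithLp 2 (X × Y) → WithLp 2 (X × Y)}
    (hT : ∀ x, T (WithLp.toLp 2 (x, 0)) = WithLp.toLp 2 (J x, 0)) (x : X) (k : ℕ) :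
    T^[k] (WithLp.toLp 2 (x, 0)) = WithLp.toLp 2 (J^[k] x, 0) := by
  induction k with
  | zero => rfl
  | succ k ih => rw [Function.iterate_succ_apply', ih, hT, Function.iterate_succ_apply']

variable [CompleteSpace X] [CompleteSpace Y]

omit [CompleteSpace X] in
theorem drC_apply (w : X) : drC X w = WithLp.toLp 2 (w, -w) := rfl

theorem adjoint_drC (z : WithLp 2 (X × X)) : (drC X).adjoint z = z.fst - z.snd := by
  refine ext_inner_right ℝ fun w => ?_
  rw [ContinuousLinearMap.adjoint_inner_left, drC_apply, WithLp.prod_inner_apply, inner_sub_left]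
  simp [sub_eq_add_neg]

theorem mem_zer_primalDualOp (L : X →L[ℝ] Y) {A : X → Set X} {x : X} (hx : x ∈ zer A) :
    WithLp.toLp 2 (x, 0) ∈ zer (primalDualOp L A (zeroOp Y)) := by
  simp only [zer, Set.mem_ofPred_eq] at hx
  simpa [zer, primalDualOp, inv, zeroOp] using hx

omit [NormedAddCommGroup X] [InnerProductSpace ℝ X] [InnerProductSpace ℝ Y] [CompleteSpace X]
  [CompleteSpace Y] in
theorem eq_toLp_zero_iff (z : WithLp 2 (X × Y)) (x : X) :
    z = WithLp.toLp 2 (x, 0) ↔ x = z.fst ∧ z.snd = 0 := by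
  constructor
  · rintro rfl
    exact ⟨rfl, rfl⟩
  · rintro ⟨h1, h2⟩
    rw [h1, ← h2]
    rfl

/-- The first component of `C C* z` plus the coupling term `z.snd` is just `z.fst`, which leaves the
resolvent inclusion at `w`. -/
theorem mem_inv_addMap_drA_iff (J : X → X) (w : X) (z : WithLp 2 (X × X)) :
    z ∈ inv (addMap (drC X ∘L (drC X).adjoint) (drA (ofResolvent J) (zeroOp X))) (drC X w) ↔
      z = WithLp.toLp 2 (J w, 0) := by
  have h1 : z ∈ inv (addMap (drC X ∘L (drC X).adjoint) (drA (ofResolvent J) (zeroOp X)))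
      (drC X w) ↔ J (z.fst + (w - (drC X).adjoint z - z.snd)) = z.fst ∧ z.snd = 0 := by
    simp only [inv, addMap, drA, primalDualOp, ofResolvent, zeroOp, Set.mem_ofPred_eq,
      Set.mem_singleton_iff, ContinuousLinearMap.adjoint_id]
    rfl
  have h2 : z.fst + (w - (drC X).adjoint z - z.snd) = w := by
    rw [adjoint_drC]
    abel
  rw [h1, h2, eq_toLp_zero_iff]

/-- The preconditioner cancels the coupling `L* z'.snd` in the first row; multiplying that row by
`σ` turns `σ⁻¹ B` into `B` and leaves a resolvent step. -/
theorem mem_pppOp_cpM_iff (J : X → X) (L : X →L[ℝ] Y) {σ : ℝ} (τ : ℝ) (hσ : 0 < σ)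
    (z z' : WithLp 2 (X × Y)) :
    z' ∈ pppOp (cpM L σ τ) (primalDualOp L (scale σ⁻¹ (ofResolvent J)) (zeroOp Y)) z ↔
      z' = WithLp.toLp 2 (J (z.fst - σ • L.adjoint z.snd), 0) := by
  have h1 : z' ∈ pppOp (cpM L σ τ) (primalDualOp L (scale σ⁻¹ (ofResolvent J)) (zeroOp Y)) z ↔
      (∃ v, J (z'.fst + v) = z'.fst ∧ σ⁻¹ • v = (σ⁻¹ • z.fst - L.adjoint z.snd)
        - (σ⁻¹ • z'.fst - L.adjoint z'.snd) - L.adjoint z'.snd) ∧ z'.snd = 0 := by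
    simp only [pppOp, inv, addMap, primalDualOp, scale, ofResolvent, zeroOp, Set.mem_ofPred_eq,
      Set.mem_singleton_iff]
    rfl
  have h2 : ∀ v, σ⁻¹ • v = (σ⁻¹ • z.fst - L.adjoint z.snd)
        - (σ⁻¹ • z'.fst - L.adjoint z'.snd) - L.adjoint z'.snd ↔
      v = z.fst - σ • L.adjoint z.snd - z'.fst := fun v => by
    rw [inv_smul_eq_iff₀ hσ.ne', sub_sub, sub_add_cancel, smul_sub, smul_sub,
      smul_inv_smul₀ hσ.ne', smul_inv_smul₀ hσ.ne']
  rw [h1, eq_toLp_zero_iff]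
  simp only [h2, exists_eq_right, add_sub_cancel]

end Splitting

end MonotoneOp
end

/-! ### Assembly of the counterexample. -/

open MonotoneOp in
theorem proposition2p4 :
    ∃ (B : Ell2 → Set Ell2) (J : Ell2 → Ell2) (s₀ sbar : Ell2),
      IsMaximallyMonotone B ∧ Bornology.IsBounded (dom B) ∧
      (∀ x, resolventOp B x = {J x}) ∧
      sbar ∈ zer B ∧ ConvergesOnlyWeakly (fun k => J^[k] s₀) sbar ∧
      -- Douglas-Rachford with `A₁ = B`, `A₂ = 0`
      (∃ (T : WithLp 2 (Ell2 × Ell2) → WithLp 2 (Ell2 × Ell2)) (Tred : Ell2 → Ell2),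
        (∀ z, pppOp (drM Ell2) (drA B (zeroOp Ell2)) z = {T z}) ∧
        (∀ w, reducedOp (drC Ell2) (drA B (zeroOp Ell2)) w = {Tred w}) ∧
        WithLp.toLp 2 (sbar, 0) ∈ zer (drA B (zeroOp Ell2)) ∧
        ConvergesOnlyWeakly (fun k => T^[k] (WithLp.toLp 2 (s₀, 0)))
          (WithLp.toLp 2 (sbar, 0)) ∧
        ConvergesOnlyWeakly (fun k => Tred^[k] ((drC Ell2).adjoint (WithLp.toLp 2 (s₀, 0))))
          sbar) ∧
      -- Chambolle-Pock with `A₁ = σ⁻¹ B`, `A₂ = 0`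
      (∀ (Y : Type u) [NormedAddCommGroup Y] [InnerProductSpace ℝ Y] [CompleteSpace Y]
        (L : Ell2 →L[ℝ] Y) (σ τ : ℝ), 0 < σ → 0 < τ → σ * τ * ‖L‖ ^ 2 ≤ 1 →
        ∃ T : WithLp 2 (Ell2 × Y) → WithLp 2 (Ell2 × Y),
          (∀ z, pppOp (cpM L σ τ) (primalDualOp L (scale σ⁻¹ B) (zeroOp Y)) z = {T z}) ∧
          WithLp.toLp 2 (sbar, 0) ∈ zer (primalDualOp L (scale σ⁻¹ B) (zeroOp Y)) ∧
          ConvergesOnlyWeakly (fun k => T^[k] (WithLp.toLp 2 (s₀, 0)))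
            (WithLp.toLp 2 (sbar, 0))) := by
  obtain ⟨J, x, hJ, hbdd, hJ0, hx, hconv⟩ := exists_isFirmlyNonexpansive_orbit
  have hit : ∀ k, J^[k] (x 0) = x k := fun k => by
    induction k with
    | zero => rfl
    | succ k ih => rw [Function.iterate_succ_apply', ih, hx]
  have hzer : (0 : Ell2) ∈ zer (ofResolvent J) := by
    simpa [zer, ofResolvent] using hJ0
  have hconv' : ConvergesOnlyWeakly (fun k => J^[k] (x 0)) 0 := by
    simpa only [hit] using hconv
  refine ⟨ofResolvent J, J, x 0, 0, hJ.isMaximallyMonotone,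
    hbdd.subset (dom_ofResolvent_subset J), resolventOp_ofResolvent J, hzer, hconv',
    ⟨fun z => WithLp.toLp 2 (J ((drC Ell2).adjoint z), 0), J, fun z => ?_, fun w => ?_,
      mem_zer_primalDualOp _ hzer, ?_, ?_⟩, ?_⟩
  · ext z'
    exact mem_inv_addMap_drA_iff J ((drC Ell2).adjoint z) z'
  · have h : inv (addMap (drC Ell2 ∘L (drC Ell2).adjoint)
        (drA (ofResolvent J) (zeroOp Ell2))) (drC Ell2 w) = {WithLp.toLp 2 (J w, 0)} :=
      Set.ext (mem_inv_addMap_drA_iff J w)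
    rw [reducedOp, h, Set.image_singleton, adjoint_drC]
    simp
  · have h := iterate_toLp_zero (J := J)
      (T := fun z => WithLp.toLp 2 (J ((drC Ell2).adjoint z), (0 : Ell2)))
      (fun y => by simp [adjoint_drC])
    simp only [h]
    exact hconv'.prod_zero
  · have h : (drC Ell2).adjoint (WithLp.toLp 2 (x 0, 0)) = x 0 := by simp [adjoint_drC]
    simpa only [h] using hconv'
  · intro Y _ _ _ L σ τ hσ _ _
    refine ⟨fun z => WithLp.toLp 2 (J (z.fst - σ • L.adjoint z.snd), 0), fun z => ?_,
      mem_zer_primalDualOp L ?_, ?_⟩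
    · ext z'
      exact mem_pppOp_cpM_iff J L τ hσ z z'
    · exact ⟨0, hzer, smul_zero _⟩
    · have h := iterate_toLp_zero (J := J)
        (T := fun z : WithLp 2 (Ell2 × Y) =>
          WithLp.toLp 2 (J (z.fst - σ • L.adjoint z.snd), (0 : Y)))
        (fun y => by simp)
      simp only [h]
      exact hconv'.prod_zero
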